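/- **Theorem (Jin–Kang–Steffen).** A signed graph $(G,\sigma)$ is a finite simple graph $G$ together with a signature $\sigma:E(G)\to\{+1,-1\}$. A coloring of $(G,\sigma)$ is a map $c:V(G)\to\mathbb{Z}$ with $c(u)\neq\sigma(uv)\,c(v)$ for every edge $uv\in E(G)$. For $k\in\mathbb{N}$, $(G,\sigma)$ is signed $k$-choosable if for every assignment $L$ of finite sets $L(v)\subseteq\mathbb{Z}$ to the vertices $v$ with $|L(v)|\ge k$ for all $v$, there is a coloring $c$ of $(G,\sigma)$ with $c(v)\in L(v)$ for all $v$. The signed list chromatic number is $$\chi_\ell^s(G,\sigma)=\min\{k\in\mathbb{N}:(G,\sigma)\text{ is signed }k\text{-choosable}\}.$$ The graph $G$ is planar if it can be embedded in the plane: its vertices are mapped to distinct points of $\mathbb{R}^2$ and its edges to simple polygonal arcs between their ends, such that the interior of an edge contains no vertex and no point of any other edge. The signed graph $(G,\sigma)$ is planar if $G$ is. Every planar signed graph $(G,\sigma)$ is signed $5$-choosable, that is, $\chi_\ell^s(G,\sigma)\le 5$. -/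

import Mathlib

/-- The Euclidean plane. -/
abbrev Plane : Type := EuclideanSpace ℝ (Fin 2)

/-- `A` is a (simple) polygonal arc from `x` to `y`: it is the union of finitely many
nondegenerate straight line segments `[p 0, p 1], …, [p (n - 1), p n]`, with `n ≥ 1`, `p 0 = x`
and `p n = y`, where consecutive segments meet exactly in their common end `p (i + 1)` and
non-consecutive segments are disjoint. -/
def IsPolygonalArc (A : Set Plane) (x y : Plane) : Prop :=
  ∃ (n : ℕ) (p : ℕ → Plane),
    0 < n ∧ p 0 = x ∧ p n = y ∧
    (∀ i, i < n → p i ≠ p (i + 1)) ∧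
    (∀ i, i + 1 < n →
      segment ℝ (p i) (p (i + 1)) ∩ segment ℝ (p (i + 1)) (p (i + 2)) = {p (i + 1)}) ∧
    (∀ i j, i + 1 < j → j < n →
      Disjoint (segment ℝ (p i) (p (i + 1))) (segment ℝ (p j) (p (j + 1)))) ∧
    A = ⋃ i ∈ Set.Iio n, segment ℝ (p i) (p (i + 1))

/-- An embedding of a graph in the plane: distinct vertices go to distinct points, every edge
goes to a polygonal arc between its two ends, and the interior of an edge contains neither a
vertex nor a point of another edge. (The values of `arc` off the edge set are irrelevant.) -/
structure PlaneEmbedding {V : Type*} (G : SimpleGraph V) where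
  point : V → Plane
  point_injective : Function.Injective point
  arc : Sym2 V → Set Plane
  isPolygonalArc_arc : ∀ u v, G.Adj u v → IsPolygonalArc (arc s(u, v)) (point u) (point v)
  vertex_notMem_interior : ∀ e ∈ G.edgeSet, ∀ w, point w ∈ arc e → w ∈ e
  disjoint_interior : ∀ e ∈ G.edgeSet, ∀ f ∈ G.edgeSet, e ≠ f →
    Disjoint (arc e \ {z | ∃ w ∈ e, point w = z}) (arc f)

/-- A graph is planar if it can be embedded in the plane. -/
def IsPlanar {V : Type*} (G : SimpleGraph V) : Prop :=
  Nonempty (PlaneEmbedding G)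

/-- A signed graph: a simple graph with a signature `E(G) → {+1, -1}` (here `ℤˣ = {1, -1}`). -/
structure SignedGraph (V : Type*) where
  graph : SimpleGraph V
  sign : graph.edgeSet → ℤˣ

namespace SignedGraph

variable {V : Type*}

/-- A coloring of a signed graph: `c u ≠ σ(uv) c v` for every edge `uv`. -/
def IsColoring (S : SignedGraph V) (c : V → ℤ) : Prop :=
  ∀ (u v : V) (h : S.graph.Adj u v),
    c u ≠ ((S.sign ⟨s(u, v), S.graph.mem_edgeSet.mpr h⟩ : ℤˣ) : ℤ) * c v

/-- Signed `k`-choosability: there is a coloring from every assignment of finite lists of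
integers of size at least `k`. -/
def IsChoosable (S : SignedGraph V) (k : ℕ) : Prop :=
  ∀ L : V → Finset ℤ, (∀ v, k ≤ (L v).card) → ∃ c : V → ℤ, S.IsColoring c ∧ ∀ v, c v ∈ L v

/-- The signed list chromatic number: the least `k` such that the signed graph is signed
`k`-choosable. -/
noncomputable def listChromaticNumber (S : SignedGraph V) : ℕ :=
  sInf {k : ℕ | S.IsChoosable k}

end SignedGraph

/-! The coloring argument is Thomassen's induction. A colored neighbor `v` of `u` forbids exactly
one color at `u`, namely `s u v * c v`, and multiplication by a sign is injective, so counting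
colors works as for ordinary list coloring.

No faces or outer cycles are used. A connected set `D` disjoint from the uncolored region `U` plays
the role of the exterior. `O ⊆ U` contains every vertex allowed a short list, and each of its
members has a neighbor in `D`. Deleted vertices are moved into `D`, except at a restart. If no
clique of at most two vertices in `O` separates `G[U]`, then a vertex of `O` has at most two
neighbors in `O` (`Unseparated.not_three_adj`), since a third would give a `K₅` or `K₃,₃` minor,
with `D` contracted to one vertex. Hence, once two adjacent vertices are precolored, a vertex `v ∈ O
\ K` next to one of them, `p`, has at most one other neighbor in `O`. Two colors reserved for `v`
therefore suffice.

Planarity enters only through the exclusion of these two minors. Disjoint connected branch sets give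
a continuous drawing in which independent edges are disjoint. `logChange_sub_comm` turns each pair
of independent edges into a linear equation between integer winding numbers, and for `K₅` and `K₃,₃`
these equations contradict each other by parity. -/

/-! ### Continuous logarithms and the change of angle between disjoint paths. -/

open Complex in
/-- A nowhere vanishing continuous function on a real topological vector space has a continuous
logarithm. -/
theorem exists_continuous_exp_eq {E : Type*} [NormedAddCommGroup E] [NormedSpace ℝ E]
    {f : E → ℂ} (hf : Continuous f) (h0 : ∀ x, f x ≠ 0) :
    ∃ g : E → ℂ, Continuous g ∧ ∀ x, exp (g x) = f x := by
  have hU : IsSimplyConnected (Set.univ : Set E) := by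
    rw [IsSimplyConnected]
    have := (convex_univ (𝕜 := ℝ) (E := E)).contractibleSpace Set.univ_nonempty
    infer_instance
  obtain ⟨g, hg, hgf⟩ := exists_continuousOn_eqOn_exp_comp hU isOpen_univ hf.continuousOn
    (by rintro ⟨x, -, hx⟩; exact h0 x hx)
  exact ⟨g, continuousOn_univ.mp hg, fun x => hgf (Set.mem_univ x)⟩

open Complex in
/-- Two continuous logarithms of the same function on the line change by the same amount. -/
theorem sub_eq_sub_of_exp_eq {f g : ℝ → ℂ} (hf : Continuous f) (hg : Continuous g)
    (h : ∀ t, exp (f t) = exp (g t)) (s t : ℝ) : f s - f t = g s - g t := by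
  have hpi : (2 * Real.pi * I : ℂ) ≠ 0 := two_pi_I_ne_zero
  choose n hn using fun t => exp_eq_exp_iff_exists_int.mp (h t)
  have hcont : Continuous fun t => ((n t : ℤ) : ℝ) := by
    have : (fun t => ((n t : ℤ) : ℝ)) = fun t => ((f t - g t) / (2 * Real.pi * I)).re := by
      funext t
      rw [hn t, add_sub_cancel_left, mul_div_cancel_right₀ _ hpi]
      simp
    rw [this]
    exact continuous_re.comp ((hf.sub hg).div_const _)
  have hcont' : Continuous n := Int.isClosedEmbedding_coe_real.isInducing.continuous_iff.mpr hcont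
  have hst : n s = n t := PreconnectedSpace.constant inferInstance hcont'
  rw [hn s, hn t, hst]
  ring

open Complex Classical in
/-- The change of a continuous logarithm of `f` from `0` to `1`. -/
noncomputable def logChange (f : ℝ → ℂ) : ℂ :=
  if h : ∃ g : ℝ → ℂ, Continuous g ∧ ∀ t, exp (g t) = f t then h.choose 1 - h.choose 0 else 0

open Complex in
theorem logChange_eq {f g : ℝ → ℂ} (hg : Continuous g) (h : ∀ t, exp (g t) = f t) :
    logChange f = g 1 - g 0 := by
  have hex : ∃ g : ℝ → ℂ, Continuous g ∧ ∀ t, exp (g t) = f t := ⟨g, hg, h⟩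
  rw [logChange, dif_pos hex]
  exact sub_eq_sub_of_exp_eq hex.choose_spec.1 hg
    (fun t => (hex.choose_spec.2 t).trans (h t).symm) 1 0

-- Logarithms of one number differ by multiples of `2πi`; the integer is a winding number relative
-- to the chosen end logarithms `p` and `q`.
open Complex in
theorem exists_logChange_eq {f : ℝ → ℂ} (hf : Continuous f) (h0 : ∀ t, f t ≠ 0) {p q : ℂ}
    (hp : exp p = f 0) (hq : exp q = f 1) :
    ∃ n : ℤ, logChange f = q - p + n * (2 * Real.pi * I) := by
  obtain ⟨g, hg, hgf⟩ := exists_continuous_exp_eq hf h0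
  obtain ⟨a, ha⟩ := exp_eq_exp_iff_exists_int.mp ((hgf 0).trans hp.symm)
  obtain ⟨b, hb⟩ := exp_eq_exp_iff_exists_int.mp ((hgf 1).trans hq.symm)
  refine ⟨b - a, ?_⟩
  rw [logChange_eq hg hgf, ha, hb]
  push_cast
  ring

open Complex in
/-- For two disjoint paths, the change of the angle under which one path is seen from an end of the
other, taken between the two ends, is symmetric in the two paths. -/
theorem logChange_sub_comm {a b c d : ℂ} (γ : Path a b) (δ : Path c d)
    (h : ∀ s t, γ.extend s ≠ δ.extend t) :
    logChange (fun s => γ.extend s - d) - logChange (fun s => γ.extend s - c) =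
      logChange (fun t => δ.extend t - b) - logChange (fun t => δ.extend t - a) := by
  -- With one logarithm `g` of the difference in both parameters, both sides become `g (1, 1) - g
  -- (0, 1) - g (1, 0) + g (0, 0)`. Reversing the difference adds the constant `πi`, which cancels.
  obtain ⟨g, hg, hgf⟩ := exists_continuous_exp_eq
    (f := fun x : ℝ × ℝ => γ.extend x.1 - δ.extend x.2) (by fun_prop)
    (fun x => sub_ne_zero.mpr (h x.1 x.2))
  have h1 (t : ℝ) : logChange (fun s => γ.extend s - δ.extend t) = g (1, t) - g (0, t) :=
    logChange_eq (g := fun s => g (s, t)) (by fun_prop) (fun s => hgf (s, t))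
  have h2 (s : ℝ) : logChange (fun t => δ.extend t - γ.extend s) = g (s, 1) - g (s, 0) := by
    rw [logChange_eq (g := fun t => g (s, t) + Real.pi * I) (by fun_prop)]
    · ring
    · intro t
      rw [exp_add, hgf, exp_pi_mul_I]
      ring
  have e1 := h1 0
  have e2 := h1 1
  have e3 := h2 0
  have e4 := h2 1
  simp only [Path.extend_zero, Path.extend_one] at e1 e2 e3 e4
  rw [e1, e2, e3, e4]
  ring

/-! ### Parity obstruction to drawing `K₅` and `K₃,₃`. -/

/-- The sign of the pair `(i, j)`: it is `1` if `j < i` and `-1` otherwise. -/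
def invSign {m : ℕ} (i j : Fin m) : ℤ := if j < i then 1 else -1

open Complex in
/-- If the edges of a graph are drawn as continuous paths such that independent edges are disjoint,
then the winding numbers of the edges around the vertices satisfy a linear equation for each pair
of independent edges. -/
theorem exists_winding_numbers {m : ℕ} (Adj : Fin m → Fin m → Prop) (z : Fin m → ℂ)
    (F : Fin m → Fin m → Set ℂ) (hz : Function.Injective z)
    (hF : ∀ i j, Adj i j → JoinedIn (F i j) (z i) (z j))
    (hz' : ∀ i j k, Adj i j → k ≠ i → k ≠ j → z k ∉ F i j)
    (hd : ∀ i j k l, Adj i j → Adj k l → i ≠ k → i ≠ l → j ≠ k → j ≠ l → Disjoint (F i j) (F k l)) :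
    ∃ n : Fin m → Fin m → Fin m → ℤ, ∀ i j k l, Adj i j → Adj k l →
      i ≠ k → i ≠ l → j ≠ k → j ≠ l →
      2 * (n i j l - n i j k - n k l j + n k l i) +
        (invSign l j - invSign l i - invSign k j + invSign k i) = 0 := by
  have hpi : (Real.pi * I : ℂ) ≠ 0 := by simp [Real.pi_ne_zero]
  -- The branch is chosen by the order of the indices, so that `l i j` and `l j i` differ by exactly
  -- `±πi`, with sign `invSign i j`.
  let l : Fin m → Fin m → ℂ := fun i j =>
    if j < i then log (z i - z j) + Real.pi * I else log (z j - z i)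
  have hl : ∀ i j, i ≠ j → exp (l i j) = z j - z i := by
    intro i j hij
    have h1 : z j - z i ≠ 0 := sub_ne_zero.mpr fun h => hij (hz h.symm)
    have h2 : z i - z j ≠ 0 := sub_ne_zero.mpr fun h => hij (hz h)
    by_cases h : j < i
    · simp [l, h, exp_add, exp_log h2]
    · simp [l, h, exp_log h1]
  have hs : ∀ i j, i ≠ j → l i j - l j i = invSign i j * (Real.pi * I) := by
    intro i j hij
    rcases lt_or_gt_of_ne hij with h | h
    · simp [l, invSign, h, h.not_gt]
    · simp [l, invSign, h, h.not_gt]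
  choose γ hγ using hF
  have hmem : ∀ i j (h : Adj i j) t, (γ i j h).extend t ∈ F i j := fun i j h t => by
    obtain ⟨s, hs⟩ : (γ i j h).extend t ∈ Set.range (γ i j h) :=
      Path.extend_range (γ i j h) ▸ Set.mem_range_self t
    exact hs ▸ hγ i j h s
  -- The integer is quantified before the hypotheses so that `choose` yields a total function; its
  -- value is 0 where they fail.
  have key : ∀ i j k, ∃ n : ℤ, ∀ h : Adj i j, k ≠ i → k ≠ j →
      logChange (fun t => (γ i j h).extend t - z k) =
        l k j - l k i + n * (2 * Real.pi * I) := by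
    intro i j k
    by_cases h : Adj i j ∧ k ≠ i ∧ k ≠ j
    · obtain ⟨h, hi, hj⟩ := h
      obtain ⟨n, hn⟩ := exists_logChange_eq
        (f := fun t => (γ i j h).extend t - z k) (by fun_prop)
        (fun t => sub_ne_zero.mpr fun e => hz' i j k h hi hj (e ▸ hmem i j h t))
        (p := l k i) (q := l k j) (by simp [hl k i hi]) (by simp [hl k j hj])
      exact ⟨n, fun _ _ _ => hn⟩
    · exact ⟨0, fun h' hi hj => absurd ⟨h', hi, hj⟩ h⟩
  choose n hn using key
  refine ⟨n, fun i j k o hij hko hik hio hjk hjo => ?_⟩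
  have e := logChange_sub_comm (γ i j hij) (γ k o hko) fun s t e =>
    Set.disjoint_left.mp (hd i j k o hij hko hik hio hjk hjo) (hmem i j hij s)
      (e ▸ hmem k o hko t)
  rw [hn i j o hij hio.symm hjo.symm, hn i j k hij hik.symm hjk.symm, hn k o j hko hjk hjo,
    hn k o i hko hik hio] at e
  have h1 := hs o j hjo.symm
  have h2 := hs o i hio.symm
  have h3 := hs k j hjk.symm
  have h4 := hs k i hik.symm
  have : ((2 * (n i j o - n i j k - n k o j + n k o i) +
        (invSign o j - invSign o i - invSign k j + invSign k i) : ℤ) : ℂ) * (Real.pi * I) = 0 := by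
    push_cast
    linear_combination e - h1 + h2 + h3 - h4
  exact_mod_cast (mul_eq_zero.mp this).resolve_right hpi

/-- The complete graph on five vertices has no drawing in which independent edges are disjoint. -/
theorem not_drawn_complete_five (z : Fin 5 → ℂ) (F : Fin 5 → Fin 5 → Set ℂ)
    (hz : Function.Injective z) (hF : ∀ i j, i ≠ j → JoinedIn (F i j) (z i) (z j))
    (hz' : ∀ i j k, i ≠ j → k ≠ i → k ≠ j → z k ∉ F i j)
    (hd : ∀ i j k l, i ≠ j → k ≠ l → i ≠ k → i ≠ l → j ≠ k → j ≠ l → Disjoint (F i j) (F k l)) :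
    False := by
  obtain ⟨n, hn⟩ := exists_winding_numbers (fun i j => i ≠ j) z F hz hF hz' hd
  have e (i j k l : Fin 5) (h : i ≠ j ∧ k ≠ l ∧ i ≠ k ∧ i ≠ l ∧ j ≠ k ∧ j ≠ l) :=
    hn i j k l h.1 h.2.1 h.2.2.1 h.2.2.2.1 h.2.2.2.2.1 h.2.2.2.2.2
  have h1 := e 0 1 2 3 (by decide)
  have h2 := e 0 1 2 4 (by decide)
  have h3 := e 0 1 3 4 (by decide)
  have h4 := e 0 2 1 3 (by decide)
  have h5 := e 0 2 1 4 (by decide)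
  have h6 := e 0 2 3 4 (by decide)
  have h7 := e 0 3 1 2 (by decide)
  have h8 := e 0 3 1 4 (by decide)
  have h9 := e 0 3 2 4 (by decide)
  have h10 := e 0 4 1 2 (by decide)
  have h11 := e 0 4 1 3 (by decide)
  have h12 := e 0 4 2 3 (by decide)
  have h13 := e 1 2 3 4 (by decide)
  have h14 := e 1 3 2 4 (by decide)
  have h15 := e 1 4 2 3 (by decide)
  clear e hn hd hz' hF hz
  simp [invSign] at *
  -- Halve the equations and add them. Each winding number occurs twice with coefficient `±1`, an
  -- even contribution. The sign term is odd exactly when the two pairs of indices interleave, that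
  -- is, when the chords cross in a convex drawing; there are 5 such pairs, so the total is odd and
  -- cannot vanish.
  omega

/-- The complete bipartite graph `K_{3,3}` has no drawing in which independent edges are
disjoint. -/
theorem not_drawn_complete_bipartite_three (z : Fin 6 → ℂ) (F : Fin 6 → Fin 6 → Set ℂ)
    (hz : Function.Injective z)
    (hF : ∀ i j : Fin 6, i < 3 ∧ 3 ≤ j → JoinedIn (F i j) (z i) (z j))
    (hz' : ∀ i j k : Fin 6, i < 3 ∧ 3 ≤ j → k ≠ i → k ≠ j → z k ∉ F i j)
    (hd : ∀ i j k l : Fin 6, i < 3 ∧ 3 ≤ j → k < 3 ∧ 3 ≤ l → i ≠ k → i ≠ l → j ≠ k → j ≠ l →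
      Disjoint (F i j) (F k l)) :
    False := by
  obtain ⟨n, hn⟩ := exists_winding_numbers (fun i j => i < 3 ∧ 3 ≤ j) z F hz hF hz' hd
  have e (i j k l : Fin 6)
      (h : (i < 3 ∧ 3 ≤ j) ∧ (k < 3 ∧ 3 ≤ l) ∧ i ≠ k ∧ i ≠ l ∧ j ≠ k ∧ j ≠ l) :=
    hn i j k l h.1 h.2.1 h.2.2.1 h.2.2.2.1 h.2.2.2.2.1 h.2.2.2.2.2
  have a1 := e 0 3 1 4 (by decide)
  have a2 := e 0 3 1 5 (by decide)
  have a3 := e 0 4 1 3 (by decide)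
  have a4 := e 0 4 1 5 (by decide)
  have a5 := e 0 5 1 3 (by decide)
  have a6 := e 0 5 1 4 (by decide)
  have b1 := e 0 3 2 4 (by decide)
  have b2 := e 0 3 2 5 (by decide)
  have b3 := e 0 4 2 3 (by decide)
  have b4 := e 0 4 2 5 (by decide)
  have b5 := e 0 5 2 3 (by decide)
  have b6 := e 0 5 2 4 (by decide)
  have c1 := e 1 3 2 4 (by decide)
  have c2 := e 1 3 2 5 (by decide)
  have c3 := e 1 4 2 3 (by decide)
  have c4 := e 1 4 2 5 (by decide)
  have c5 := e 1 5 2 3 (by decide)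
  have c6 := e 1 5 2 4 (by decide)
  clear e hn hd hz' hF hz
  simp [invSign] at *
  -- The same parity count: every winding number again occurs twice, and 9 pairs of edges
  -- interleave.
  omega

/-! ### Connected vertex sets and the drawings they give. -/

/-- The graph induced on `S` is connected or empty: no proper nonempty subset of `S` is closed
under adjacency in `S`. -/
def ConnectedOn {V : Type*} (G : SimpleGraph V) (S : Set V) : Prop :=
  ∀ T ⊆ S, T.Nonempty → (∀ x ∈ T, ∀ y ∈ S, G.Adj x y → y ∈ T) → S ⊆ T

theorem connectedOn_singleton {V : Type*} (G : SimpleGraph V) (v : V) : ConnectedOn G {v} := by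
  rintro T hT ⟨x, hx⟩ - y hy
  rw [Set.mem_singleton_iff.mp hy, ← Set.mem_singleton_iff.mp (hT hx)]
  exact hx

theorem ConnectedOn.union {V : Type*} {G : SimpleGraph V} {S T : Set V} (hS : ConnectedOn G S)
    (hT : ConnectedOn G T) {x y : V} (hx : x ∈ S) (hy : y ∈ T) (h : G.Adj x y) :
    ConnectedOn G (S ∪ T) := by
  intro A hA ⟨a, ha⟩ hc
  have h1 : (A ∩ S).Nonempty → S ⊆ A := fun hne =>
    (hS (A ∩ S) Set.inter_subset_right hne fun u hu w hw huw =>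
      ⟨hc u hu.1 w (Or.inl hw) huw, hw⟩).trans Set.inter_subset_left
  have h2 : (A ∩ T).Nonempty → T ⊆ A := fun hne =>
    (hT (A ∩ T) Set.inter_subset_right hne fun u hu w hw huw =>
      ⟨hc u hu.1 w (Or.inr hw) huw, hw⟩).trans Set.inter_subset_left
  rcases hA ha with haS | haT
  · have h3 := h1 ⟨a, ha, haS⟩
    exact Set.union_subset h3 (h2 ⟨y, hc x (h3 hx) y (Or.inr hy) h, hy⟩)
  · have h3 := h2 ⟨a, ha, haT⟩
    exact Set.union_subset (h1 ⟨x, hc y (h3 hy) x (Or.inl hx) h.symm, hx⟩) h3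

theorem IsPolygonalArc.joinedIn {A : Set Plane} {x y : Plane} (h : IsPolygonalArc A x y) :
    JoinedIn A x y := by
  obtain ⟨n, p, hn, rfl, rfl, -, -, -, rfl⟩ := h
  have hseg : ∀ i < n, segment ℝ (p i) (p (i + 1)) ⊆
      ⋃ i ∈ Set.Iio n, segment ℝ (p i) (p (i + 1)) := fun i hi =>
    Set.subset_biUnion_of_mem (u := fun i => segment ℝ (p i) (p (i + 1))) hi
  have key : ∀ k ≤ n, JoinedIn (⋃ i ∈ Set.Iio n, segment ℝ (p i) (p (i + 1))) (p 0) (p k) := by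
    intro k hk
    induction k with
    | zero => exact JoinedIn.refl (hseg 0 hn (left_mem_segment ℝ _ _))
    | succ k ih => exact (ih (by omega)).trans (JoinedIn.of_segment_subset (hseg k hk))
  exact key n le_rfl

namespace PlaneEmbedding

variable {V : Type*} {G : SimpleGraph V}

/-- The part of the plane occupied by the vertices in `S` and the edges inside `S`. -/
def drawn (E : PlaneEmbedding G) (S : Set V) : Set Plane :=
  E.point '' S ∪ ⋃ e ∈ {e ∈ G.edgeSet | ∀ w ∈ e, w ∈ S}, E.arc e

/-- A common point would be a vertex or lie on two edges, and distinct edges meet only in common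
ends. Either way some vertex would belong to both sets. -/
theorem disjoint_drawn (E : PlaneEmbedding G) {S T : Set V} (h : Disjoint S T) :
    Disjoint (E.drawn S) (E.drawn T) := by
  rw [Set.disjoint_left] at h ⊢
  rintro z (⟨v, hv, rfl⟩ | hz) hz'
  · rcases hz' with ⟨w, hw, hwv⟩ | hz'
    · exact h hv (E.point_injective hwv ▸ hw)
    · simp only [Set.mem_iUnion] at hz'
      obtain ⟨f, hf, hvf⟩ := hz'
      exact h hv (hf.2 v (E.vertex_notMem_interior f hf.1 v hvf))
  · simp only [Set.mem_iUnion] at hz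
    obtain ⟨e, he, hze⟩ := hz
    rcases hz' with ⟨w, hw, rfl⟩ | hz'
    · exact h (he.2 w (E.vertex_notMem_interior e he.1 w hze)) hw
    · simp only [Set.mem_iUnion] at hz'
      obtain ⟨f, hf, hzf⟩ := hz'
      have hef : e ≠ f := by
        rintro rfl
        induction e with
        | _ a b => exact h (he.2 a (Sym2.mem_mk_left a b)) (hf.2 a (Sym2.mem_mk_left a b))
      by_cases hend : ∃ w ∈ e, E.point w = z
      · obtain ⟨w, hwe, rfl⟩ := hend
        exact h (he.2 w hwe) (hf.2 w (E.vertex_notMem_interior f hf.1 w hzf))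
      · exact Set.disjoint_left.mp (E.disjoint_interior e he.1 f hf.1 hef) ⟨hze, hend⟩ hzf

theorem joinedIn_drawn (E : PlaneEmbedding G) {S : Set V} (hS : ConnectedOn G S) {u v : V}
    (hu : u ∈ S) (hv : v ∈ S) : JoinedIn (E.drawn S) (E.point u) (E.point v) := by
  refine (hS {w ∈ S | JoinedIn (E.drawn S) (E.point u) (E.point w)} (Set.sep_subset _ _)
    ⟨u, hu, JoinedIn.refl (Or.inl ⟨u, hu, rfl⟩)⟩ ?_ hv).2
  rintro x ⟨hx, hux⟩ y hy hxy
  have hsub : E.arc s(x, y) ⊆ E.drawn S := by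
    refine Set.subset_union_of_subset_right
      (Set.subset_biUnion_of_mem (u := E.arc) (show s(x, y) ∈ _ from ?_)) _
    refine ⟨G.mem_edgeSet.mpr hxy, fun w hw => ?_⟩
    rcases Sym2.mem_iff.mp hw with rfl | rfl <;> assumption
  exact ⟨hy, hux.trans ((E.isPolygonalArc_arc x y hxy).joinedIn.mono hsub)⟩

/-- Disjoint connected vertex sets of a plane graph give a drawing of the graph of adjacencies
between them, in which independent edges are disjoint. -/
theorem exists_drawing (E : PlaneEmbedding G) {m : ℕ} (B : Fin m → Set V)
    (Adj : Fin m → Fin m → Prop) (hne : ∀ i, (B i).Nonempty) (hB : ∀ i, ConnectedOn G (B i))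
    (hd : ∀ i j, i ≠ j → Disjoint (B i) (B j))
    (hadj : ∀ i j, Adj i j → ∃ x ∈ B i, ∃ y ∈ B j, G.Adj x y) :
    ∃ (z : Fin m → ℂ) (F : Fin m → Fin m → Set ℂ), Function.Injective z ∧
      (∀ i j, Adj i j → JoinedIn (F i j) (z i) (z j)) ∧
      (∀ i j k, k ≠ i → k ≠ j → z k ∉ F i j) ∧
      ∀ i j k l, i ≠ k → i ≠ l → j ≠ k → j ≠ l → Disjoint (F i j) (F k l) := by
  choose b hb using hne
  let φ : Plane ≃ₗᵢ[ℝ] ℂ := Complex.orthonormalBasisOneI.repr.symm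
  refine ⟨fun i => φ (E.point (b i)), fun i j => φ '' E.drawn (B i ∪ B j), ?_, ?_, ?_, ?_⟩
  · intro i j hij
    by_contra h
    exact Set.disjoint_left.mp (hd i j h) (hb i) (E.point_injective (φ.injective hij) ▸ hb j)
  · intro i j hij
    obtain ⟨x, hx, y, hy, hxy⟩ := hadj i j hij
    obtain ⟨γ, hγ⟩ := E.joinedIn_drawn ((hB i).union (hB j) hx hy hxy) (Or.inl (hb i))
      (Or.inr (hb j))
    exact ⟨γ.map φ.continuous, fun t => ⟨γ t, hγ t, rfl⟩⟩
  · rintro i j k hi hj ⟨p, hp, hpk⟩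
    have hk : E.point (b k) ∈ E.drawn (B k) := Or.inl ⟨b k, hb k, rfl⟩
    rw [φ.injective hpk] at hp
    exact Set.disjoint_left.mp (E.disjoint_drawn (((hd k i hi).union_right (hd k j hj)))) hk hp
  · intro i j k l hik hil hjk hjl
    exact (Set.disjoint_image_iff φ.injective).mpr (E.disjoint_drawn (Set.disjoint_union_left.mpr
      ⟨Set.disjoint_union_right.mpr ⟨hd _ _ hik, hd _ _ hil⟩,
        Set.disjoint_union_right.mpr ⟨hd _ _ hjk, hd _ _ hjl⟩⟩))

end PlaneEmbedding

/-! ### Forbidden minors of planar graphs. -/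

/-- `G` has no complete graph on five vertices as a minor. -/
def NoCompleteFiveMinor {V : Type*} (G : SimpleGraph V) : Prop :=
  ∀ B : Fin 5 → Set V, (∀ i, ConnectedOn G (B i)) → (∀ i j, i < j → Disjoint (B i) (B j)) →
    ¬ ∀ i j, i < j → ∃ x ∈ B i, ∃ y ∈ B j, G.Adj x y

/-- `G` has no complete bipartite graph `K_{3,3}` as a minor. -/
def NoBipartiteThreeMinor {V : Type*} (G : SimpleGraph V) : Prop :=
  ∀ B : Fin 6 → Set V, (∀ i, ConnectedOn G (B i)) → (∀ i j, i < j → Disjoint (B i) (B j)) →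
    ¬ ∀ i j : Fin 6, i < 3 → 3 ≤ j → ∃ x ∈ B i, ∃ y ∈ B j, G.Adj x y

theorem IsPlanar.noCompleteFiveMinor {V : Type*} {G : SimpleGraph V} (h : IsPlanar G) :
    NoCompleteFiveMinor G := by
  obtain ⟨E⟩ := h
  intro B hB hd hadj
  have hadj' : ∀ i j, i ≠ j → ∃ x ∈ B i, ∃ y ∈ B j, G.Adj x y := by
    intro i j hij
    rcases lt_or_gt_of_ne hij with h | h
    · exact hadj i j h
    · obtain ⟨x, hx, y, hy, hxy⟩ := hadj j i h
      exact ⟨y, hy, x, hx, hxy.symm⟩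
  -- `ConnectedOn` allows empty sets; the required adjacencies exclude them.
  have hne : ∀ i, (B i).Nonempty := by
    intro i
    obtain ⟨x, hx, -⟩ := hadj' i (i + 1) (by revert i; decide)
    exact ⟨x, hx⟩
  obtain ⟨z, F, hz, hF, hz', hF'⟩ := E.exists_drawing B (fun i j => i ≠ j) hne hB
    (fun i j hij => (lt_or_gt_of_ne hij).elim (hd i j) fun h => (hd j i h).symm) hadj'
  exact not_drawn_complete_five z F hz hF (fun i j k _ => hz' i j k)
    (fun i j k l _ _ => hF' i j k l)

theorem IsPlanar.noBipartiteThreeMinor {V : Type*} {G : SimpleGraph V} (h : IsPlanar G) :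
    NoBipartiteThreeMinor G := by
  obtain ⟨E⟩ := h
  intro B hB hd hadj
  have hne : ∀ i, (B i).Nonempty := by
    intro i
    by_cases hi : i < 3
    · obtain ⟨x, hx, -⟩ := hadj i 3 hi le_rfl
      exact ⟨x, hx⟩
    · obtain ⟨-, -, y, hy, -⟩ := hadj 0 i (by decide) (not_lt.mp hi)
      exact ⟨y, hy⟩
  obtain ⟨z, F, hz, hF, hz', hF'⟩ := E.exists_drawing B (fun i j => i < 3 ∧ 3 ≤ j) hne hB
    (fun i j hij => (lt_or_gt_of_ne hij).elim (hd i j) fun h => (hd j i h).symm)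
    (fun i j hij => hadj i j hij.1 hij.2)
  exact not_drawn_complete_bipartite_three z F hz hF (fun i j k _ => hz' i j k)
    (fun i j k l _ _ => hF' i j k l)

/-! ### Components, separations and the bound on neighbors in `O`. -/

section

variable {V : Type*}

/-- The vertices which can be reached from `y` inside `Y`. -/
def componentOn (G : SimpleGraph V) (Y : Set V) (y : V) : Set V :=
  {z | Relation.ReflTransGen (fun a b => G.Adj a b ∧ a ∈ Y ∧ b ∈ Y) y z}

theorem mem_componentOn_self (G : SimpleGraph V) (Y : Set V) (y : V) : y ∈ componentOn G Y y :=
  Relation.ReflTransGen.refl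

theorem componentOn_subset {G : SimpleGraph V} {Y : Set V} {y : V} (hy : y ∈ Y) :
    componentOn G Y y ⊆ Y := fun z hz => by
  rcases Relation.ReflTransGen.cases_tail hz with rfl | ⟨w, -, h⟩
  · exact hy
  · exact h.2.2

theorem mem_componentOn_symm {G : SimpleGraph V} {Y : Set V} {y z : V}
    (h : z ∈ componentOn G Y y) : y ∈ componentOn G Y z := by
  have : Std.Symm fun a b => G.Adj a b ∧ a ∈ Y ∧ b ∈ Y := ⟨fun a b h => ⟨h.1.symm, h.2.2, h.2.1⟩⟩
  exact Std.Symm.symm _ _ h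

theorem componentOn_eq {G : SimpleGraph V} {Y : Set V} {y z : V} (h : z ∈ componentOn G Y y) :
    componentOn G Y y = componentOn G Y z :=
  Set.Subset.antisymm (fun _ hw => (mem_componentOn_symm h).trans hw) (fun _ hw => h.trans hw)

theorem connectedOn_componentOn (G : SimpleGraph V) (Y : Set V) (y : V) :
    ConnectedOn G (componentOn G Y y) := by
  rintro T hT ⟨t, ht⟩ hc z hz
  have htz : z ∈ componentOn G Y t := componentOn_eq (hT ht) ▸ hz
  induction htz with
  | refl => exact ht
  | @tail b c hb h ih => exact hc b (ih ((hT ht).trans hb)) c hz h.1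

/-- Every separation of `G[U]` along a clique in `O` of at most two vertices is trivial. -/
def Unseparated [DecidableEq V] (G : SimpleGraph V) (U O : Finset V) : Prop :=
  ∀ A B : Finset V, A ∪ B = U → (∀ x ∈ A, x ∉ B → ∀ y ∈ B, y ∉ A → ¬ G.Adj x y) → A ∩ B ⊆ O →
    (∀ x ∈ A ∩ B, ∀ y ∈ A ∩ B, x ≠ y → G.Adj x y) → (A ∩ B).card ≤ 2 → A = U ∨ B = U

/-- If the edge `vz` does not separate `G[U]`, then `x` and `y` are adjacent or have a common
neighbouring component of `Y`, where `Y` is obtained from `U` by removing `v, x, y, z`. -/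
theorem Unseparated.exists_connector [DecidableEq V] {G : SimpleGraph V} {U O : Finset V}
    (h : Unseparated G U O) {Y : Set V} {v x y z : V} (hv : v ∈ O) (hz : z ∈ O) (hvz : G.Adj v z)
    (hvU : v ∈ U) (hzU : z ∈ U) (hxU : x ∈ U) (hyU : y ∈ U)
    (hvx : v ≠ x) (hvy : v ≠ y) (hxy : x ≠ y) (hxz : x ≠ z) (hyz : y ≠ z)
    (hY : ∀ w, w ∈ Y ↔ w ∈ U ∧ w ≠ v ∧ w ≠ x ∧ w ≠ y ∧ w ≠ z) :
    ∃ C ⊆ Y, ConnectedOn G C ∧ (∀ w ∈ C, C = componentOn G Y w) ∧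
      ((G.Adj x y ∧ C = ∅) ∨ (∃ a ∈ C, G.Adj x a) ∧ ∃ b ∈ C, G.Adj y b) := by
  classical
  by_cases hadj : G.Adj x y
  · refine ⟨∅, Set.empty_subset _, ?_, by simp, Or.inl ⟨hadj, rfl⟩⟩
    rintro T - - - w ⟨⟩
  by_cases hex : ∃ w ∈ Y, (∃ a ∈ componentOn G Y w, G.Adj x a) ∧
      ∃ b ∈ componentOn G Y w, G.Adj y b
  · obtain ⟨w, hw, hC⟩ := hex
    exact ⟨componentOn G Y w, componentOn_subset hw, connectedOn_componentOn G Y w,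
      fun u hu => componentOn_eq hu, Or.inr hC⟩
  exfalso
  -- `T` is `x` together with all components of `Y` touching `x`. Without a connector, `T ∪ {v, z}`
  -- and `U \ T` form a separation along the edge `vz`, with `x` and `y` strictly on different
  -- sides.
  let T : Finset V := U.filter fun w => w = x ∨ w ∈ Y ∧ ∃ a ∈ componentOn G Y w, G.Adj x a
  have hT : ∀ w, w ∈ T ↔ w ∈ U ∧ (w = x ∨ w ∈ Y ∧ ∃ a ∈ componentOn G Y w, G.Adj x a) :=
    fun w => Finset.mem_filter
  have hvT : v ∉ T := by simp [hT, hvx, hY]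
  have hzT : z ∉ T := by simp [hT, hxz.symm, hY]
  have hyT : y ∉ T := by simp [hT, hxy.symm, hY]
  have hxT : x ∈ T := by simp [hT, hxU]
  have hint : ∀ w, w ∈ (T ∪ {v, z}) ∩ (U \ T) ↔ w = v ∨ w = z := by
    intro w
    simp only [Finset.mem_inter, Finset.mem_union, Finset.mem_sdiff, Finset.mem_insert,
      Finset.mem_singleton]
    constructor
    · tauto
    · rintro (rfl | rfl) <;> tauto
  suffices hs : T ∪ {v, z} = U ∨ U \ T = U by
    rcases hs with hs | hs
    · rw [← hs] at hyU
      simp [hyT, hvy.symm, hyz] at hyU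
    · rw [← hs] at hxU
      simp [hxT] at hxU
  refine h (T ∪ {v, z}) (U \ T) ?_ ?_ ?_ ?_ ?_
  · ext w
    simp only [Finset.mem_union, Finset.mem_sdiff, Finset.mem_insert, Finset.mem_singleton]
    constructor
    · rintro ((h | rfl | rfl) | h)
      · exact ((hT w).mp h).1
      · exact hvU
      · exact hzU
      · exact h.1
    · tauto
  · intro a ha haB b hb hbA hab
    simp only [Finset.mem_union, Finset.mem_sdiff, Finset.mem_insert, Finset.mem_singleton,
      not_and, not_not, not_or] at ha haB hb hbA
    have haT : a ∈ T := by
      rcases ha with ha | rfl | rfl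
      · exact ha
      · exact haB hvU
      · exact haB hzU
    have hbx : b ≠ x := fun e => hbA.1 (e ▸ hxT)
    obtain ⟨haU, rfl | ⟨haY, c, hc, hxc⟩⟩ := (hT a).mp haT
    · have hby : b ≠ y := fun e => hadj (e ▸ hab)
      have hbY : b ∈ Y := (hY b).mpr ⟨hb.1, hbA.2.1, hbx, hby, hbA.2.2⟩
      exact hbA.1 ((hT b).mpr ⟨hb.1, Or.inr ⟨hbY, b, mem_componentOn_self _ _ _, hab⟩⟩)
    · have hby : b ≠ y := fun e =>
        hex ⟨a, haY, ⟨c, hc, hxc⟩, a, mem_componentOn_self _ _ _, (e ▸ hab).symm⟩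
      have hbY : b ∈ Y := (hY b).mpr ⟨hb.1, hbA.2.1, hbx, hby, hbA.2.2⟩
      have hba : a ∈ componentOn G Y b := .single ⟨hab.symm, hbY, haY⟩
      exact hbA.1 ((hT b).mpr ⟨hb.1, Or.inr ⟨hbY, c, componentOn_eq hba ▸ hc, hxc⟩⟩)
  · intro w hw
    rcases (hint w).mp hw with rfl | rfl <;> assumption
  · intro a ha b hb hab
    rcases (hint a).mp ha with rfl | rfl <;> rcases (hint b).mp hb with rfl | rfl
    · exact absurd rfl hab
    · exact hvz
    · exact hvz.symm
    · exact absurd rfl hab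
  · refine (Finset.card_le_card (t := {v, z}) fun w hw => ?_).trans Finset.card_le_two
    simpa using (hint w).mp hw

/-- Three vertices which are pairwise adjacent or joined through components of `Y` are, together
with two connected sets adjacent to all three, part of a forbidden minor. -/
theorem false_of_connectors {G : SimpleGraph V} (h5 : NoCompleteFiveMinor G)
    (h6 : NoBipartiteThreeMinor G) {D Y C₁ C₂ C₃ : Set V} {v x₁ x₂ x₃ : V}
    (hD : ConnectedOn G D) (hDY : Disjoint D Y) (hvD : v ∉ D) (hvY : v ∉ Y)
    (hx1D : x₁ ∉ D) (hx2D : x₂ ∉ D) (hx3D : x₃ ∉ D)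
    (hx1Y : x₁ ∉ Y) (hx2Y : x₂ ∉ Y) (hx3Y : x₃ ∉ Y)
    (h12 : x₁ ≠ x₂) (h13 : x₁ ≠ x₃) (h23 : x₂ ≠ x₃)
    (hDv : ∃ d ∈ D, G.Adj d v) (hD1 : ∃ d ∈ D, G.Adj d x₁) (hD2 : ∃ d ∈ D, G.Adj d x₂)
    (hD3 : ∃ d ∈ D, G.Adj d x₃) (hv1 : G.Adj v x₁) (hv2 : G.Adj v x₂) (hv3 : G.Adj v x₃)
    (hC₁ : C₁ ⊆ Y) (hC₂ : C₂ ⊆ Y) (hC₃ : C₃ ⊆ Y)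
    (hc₁ : ConnectedOn G C₁) (hc₂ : ConnectedOn G C₂) (hc₃ : ConnectedOn G C₃)
    (he₁ : ∀ w ∈ C₁, C₁ = componentOn G Y w) (he₂ : ∀ w ∈ C₂, C₂ = componentOn G Y w)
    (he₃ : ∀ w ∈ C₃, C₃ = componentOn G Y w)
    (ht₁ : (G.Adj x₁ x₂ ∧ C₁ = ∅) ∨ (∃ a ∈ C₁, G.Adj x₁ a) ∧ ∃ b ∈ C₁, G.Adj x₂ b)
    (ht₂ : (G.Adj x₂ x₃ ∧ C₂ = ∅) ∨ (∃ a ∈ C₂, G.Adj x₂ a) ∧ ∃ b ∈ C₂, G.Adj x₃ b)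
    (ht₃ : (G.Adj x₃ x₁ ∧ C₃ = ∅) ∨ (∃ a ∈ C₃, G.Adj x₃ a) ∧ ∃ b ∈ C₃, G.Adj x₁ b) :
    False := by
  -- A component touching all three `xᵢ` gives `K₃,₃` with sides `D, v, C` and `x₁, x₂, x₃`.
  have claw : ∀ C ⊆ Y, ConnectedOn G C → (∃ a ∈ C, G.Adj x₁ a) → (∃ a ∈ C, G.Adj x₂ a) →
      (∃ a ∈ C, G.Adj x₃ a) → False := by
    rintro C hC hc ⟨a₁, ha₁, h₁⟩ ⟨a₂, ha₂, h₂⟩ ⟨a₃, ha₃, h₃⟩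
    have hDC : Disjoint D C := hDY.mono_right hC
    have k0 : v ∉ C := fun h => hvY (hC h)
    have k1 : x₁ ∉ C := fun h => hx1Y (hC h)
    have k2 : x₂ ∉ C := fun h => hx2Y (hC h)
    have k3 : x₃ ∉ C := fun h => hx3Y (hC h)
    refine h6 ![D, {v}, C, {x₁}, {x₂}, {x₃}] ?_ ?_ ?_
    · intro i
      fin_cases i
      exacts [hD, connectedOn_singleton G v, hc, connectedOn_singleton G x₁,
        connectedOn_singleton G x₂, connectedOn_singleton G x₃]
    · intro i j hij
      fin_cases i <;> fin_cases j <;>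
        first
        | exact absurd hij (by decide)
        | simp [hDC, hvD, hx1D, hx2D, hx3D, k0, k1, k2, k3, hv1.ne, hv2.ne, hv3.ne, h12, h13, h23]
    · intro i j hi hj
      fin_cases i <;> fin_cases j <;>
        first
        | exact absurd hi (by decide)
        | exact absurd hj (by decide)
        | skip
      · simpa using hD1
      · simpa using hD2
      · simpa using hD3
      · simpa using hv1
      · simpa using hv2
      · simpa using hv3
      · exact ⟨a₁, ha₁, x₁, rfl, h₁.symm⟩
      · exact ⟨a₂, ha₂, x₂, rfl, h₂.symm⟩
      · exact ⟨a₃, ha₃, x₃, rfl, h₃.symm⟩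
  have touch : ∀ {C : Set V} {w : V} {p : Prop} {q : Prop}, w ∈ C → (p ∧ C = ∅) ∨ q → q := by
    rintro C w p q hw (⟨-, rfl⟩ | h)
    · exact hw.elim
    · exact h
  -- Connectors sharing a vertex are the same component, which then touches all three `xᵢ`.
  have d12 : Disjoint C₁ C₂ := Set.disjoint_left.mpr fun w hw₁ hw₂ => by
    have e : C₂ = C₁ := (he₂ w hw₂).trans (he₁ w hw₁).symm
    have t₁ := touch hw₁ ht₁
    have t₂ := touch hw₂ ht₂
    rw [e] at t₂
    exact claw C₁ hC₁ hc₁ t₁.1 t₁.2 t₂.2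
  have d13 : Disjoint C₁ C₃ := Set.disjoint_left.mpr fun w hw₁ hw₃ => by
    have e : C₃ = C₁ := (he₃ w hw₃).trans (he₁ w hw₁).symm
    have t₁ := touch hw₁ ht₁
    have t₃ := touch hw₃ ht₃
    rw [e] at t₃
    exact claw C₁ hC₁ hc₁ t₁.1 t₁.2 t₃.1
  have d23 : Disjoint C₂ C₃ := Set.disjoint_left.mpr fun w hw₂ hw₃ => by
    have e : C₃ = C₂ := (he₃ w hw₃).trans (he₂ w hw₂).symm
    have t₂ := touch hw₂ ht₂
    have t₃ := touch hw₃ ht₃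
    rw [e] at t₃
    exact claw C₂ hC₂ hc₂ t₃.2 t₂.1 t₂.2
  have conn : ∀ {C : Set V} {x y : V}, ConnectedOn G C →
      ((G.Adj x y ∧ C = ∅) ∨ (∃ a ∈ C, G.Adj x a) ∧ ∃ b ∈ C, G.Adj y b) →
      ConnectedOn G ({x} ∪ C) := by
    rintro C x y hC (⟨-, rfl⟩ | ⟨⟨a, ha, hxa⟩, -⟩)
    · rw [Set.union_empty]
      exact connectedOn_singleton G x
    · exact (connectedOn_singleton G x).union hC rfl ha hxa
  have edge : ∀ {C C' : Set V} {x y : V},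
      ((G.Adj x y ∧ C = ∅) ∨ (∃ a ∈ C, G.Adj x a) ∧ ∃ b ∈ C, G.Adj y b) →
      ∃ a ∈ {x} ∪ C, ∃ b ∈ {y} ∪ C', G.Adj a b := by
    rintro C C' x y (⟨h, -⟩ | ⟨-, b, hb, hyb⟩)
    · exact ⟨x, Or.inl rfl, y, Or.inl rfl, h⟩
    · exact ⟨b, Or.inr hb, y, Or.inl rfl, hyb.symm⟩
  have attach : ∀ {S C : Set V} {x : V}, (∃ d ∈ S, G.Adj d x) →
      ∃ a ∈ S, ∃ b ∈ {x} ∪ C, G.Adj a b := by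
    rintro S C x ⟨d, hd, h⟩
    exact ⟨d, hd, x, Or.inl rfl, h⟩
  have disj : ∀ {S C : Set V} {x : V}, x ∉ S → Disjoint S C → Disjoint S ({x} ∪ C) := by
    intro S C x hx h
    exact Set.disjoint_union_right.mpr ⟨Set.disjoint_singleton_right.mpr hx, h⟩
  have disj' : ∀ {C C' : Set V} {x y : V}, C ⊆ Y → C' ⊆ Y → x ∉ Y → y ∉ Y → x ≠ y →
      Disjoint C C' → Disjoint ({x} ∪ C) ({y} ∪ C') := by
    intro C C' x y hC hC' hx hy hxy h
    refine disj ?_ (Set.disjoint_union_left.mpr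
      ⟨Set.disjoint_singleton_left.mpr fun h => hx (hC' h), h⟩)
    rintro (h | h)
    · exact hxy h.symm
    · exact hy (hC h)
  have vdisj : ∀ {C : Set V}, C ⊆ Y → Disjoint {v} C := fun hC =>
    Set.disjoint_singleton_left.mpr fun h => hvY (hC h)
  -- Each connector is absorbed by one of its ends, cyclically: `C₁` leads to `x₂`, `C₂` to `x₃` and
  -- `C₃` back to `x₁`.
  refine h5 ![D, {v}, {x₁} ∪ C₁, {x₂} ∪ C₂, {x₃} ∪ C₃] ?_ ?_ ?_
  · intro i
    fin_cases i
    exacts [hD, connectedOn_singleton G v, conn hc₁ ht₁, conn hc₂ ht₂, conn hc₃ ht₃]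
  · intro i j hij
    fin_cases i <;> fin_cases j <;>
      first
      | exact absurd hij (by decide)
      | skip
    · exact Set.disjoint_singleton_right.mpr hvD
    · exact disj hx1D (hDY.mono_right hC₁)
    · exact disj hx2D (hDY.mono_right hC₂)
    · exact disj hx3D (hDY.mono_right hC₃)
    · exact disj hv1.ne' (vdisj hC₁)
    · exact disj hv2.ne' (vdisj hC₂)
    · exact disj hv3.ne' (vdisj hC₃)
    · exact disj' hC₁ hC₂ hx1Y hx2Y h12 d12
    · exact disj' hC₁ hC₃ hx1Y hx3Y h13 d13
    · exact disj' hC₂ hC₃ hx2Y hx3Y h23 d23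
  · intro i j hij
    fin_cases i <;> fin_cases j <;>
      first
      | exact absurd hij (by decide)
      | skip
    · obtain ⟨d, hd, h⟩ := hDv
      exact ⟨d, hd, v, rfl, h⟩
    · exact attach hD1
    · exact attach hD2
    · exact attach hD3
    · exact attach ⟨v, rfl, hv1⟩
    · exact attach ⟨v, rfl, hv2⟩
    · exact attach ⟨v, rfl, hv3⟩
    · exact edge ht₁
    · obtain ⟨a, ha, b, hb, h⟩ := edge (C' := C₁) ht₃
      exact ⟨b, hb, a, ha, h.symm⟩
    · exact edge ht₂

/-- Let `D` be a connected set outside `U`, and `O` a set of vertices of `U` with a neighbour in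
`D`. If `G[U]` has no separating clique of at most two vertices in `O`, then a vertex of `O` has at
most two neighbours in `O`. -/
theorem Unseparated.not_three_adj [DecidableEq V] {G : SimpleGraph V} {U O : Finset V}
    (h : Unseparated G U O) (h5 : NoCompleteFiveMinor G) (h6 : NoBipartiteThreeMinor G)
    {D : Set V} (hD : ConnectedOn G D) (hDU : ∀ w ∈ U, w ∉ D) (hOU : O ⊆ U)
    (hO : ∀ w ∈ O, ∃ d ∈ D, G.Adj d w) {v x y z : V} (hv : v ∈ O) (hx : x ∈ O) (hy : y ∈ O)
    (hz : z ∈ O) (hxy : x ≠ y) (hxz : x ≠ z) (hyz : y ≠ z) (hvx : G.Adj v x) (hvy : G.Adj v y)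
    (hvz : G.Adj v z) : False := by
  let Y : Set V := {w | w ∈ U ∧ w ≠ v ∧ w ≠ x ∧ w ≠ y ∧ w ≠ z}
  obtain ⟨C₁, hC₁, hc₁, he₁, ht₁⟩ := h.exists_connector (Y := Y) (x := x) (y := y) hv hz hvz
    (hOU hv) (hOU hz) (hOU hx) (hOU hy) hvx.ne hvy.ne hxy hxz hyz (fun w => Iff.rfl)
  obtain ⟨C₂, hC₂, hc₂, he₂, ht₂⟩ := h.exists_connector (Y := Y) (x := y) (y := z) hv hx hvx
    (hOU hv) (hOU hx) (hOU hy) (hOU hz) hvy.ne hvz.ne hyz hxy.symm hxz.symm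
    (fun w => by simp only [Y, Set.mem_ofPred_eq]; tauto)
  obtain ⟨C₃, hC₃, hc₃, he₃, ht₃⟩ := h.exists_connector (Y := Y) (x := z) (y := x) hv hy hvy
    (hOU hv) (hOU hy) (hOU hz) (hOU hx) hvz.ne hvx.ne hxz.symm hyz.symm hxy
    (fun w => by simp only [Y, Set.mem_ofPred_eq]; tauto)
  exact false_of_connectors h5 h6 hD
    (Set.disjoint_left.mpr fun w hw hwY => hDU w hwY.1 hw) (hDU v (hOU hv)) (fun h => h.2.1 rfl)
    (hDU x (hOU hx)) (hDU y (hOU hy)) (hDU z (hOU hz)) (fun h => h.2.2.1 rfl)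
    (fun h => h.2.2.2.1 rfl) (fun h => h.2.2.2.2 rfl) hxy hxz hyz (hO v hv) (hO x hx) (hO y hy)
    (hO z hz) hvx hvy hvz hC₁ hC₂ hC₃ hc₁ hc₂ hc₃ he₁ he₂ he₃ ht₁ ht₂ ht₃

/-! ### Precolored configurations and Thomassen's induction. -/

/-- A coloring of `G[U]` from the lists `L` which agrees with `c₀` on `K`; the color `c u` of `u`
must differ from `s u v * c v` for every neighbour `v`. -/
def ExtendsTo (G : SimpleGraph V) (s : V → V → ℤ) (L : V → Finset ℤ) (U K : Finset V)
    (c₀ : V → ℤ) : Prop :=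
  ∃ c : V → ℤ, (∀ u ∈ K, c u = c₀ u) ∧ (∀ u ∈ U, u ∉ K → c u ∈ L u) ∧
    ∀ u ∈ U, ∀ v ∈ U, G.Adj u v → c u ≠ s u v * c v

/-- The situation in Thomassen's induction: `O` consists of vertices of `U` with a neighbour in the
connected set `D`, the clique `K` in `O` is colored by `c₀`, and the lists have at least
three colors on `U \ K` and at least five on `U \ O`. -/
structure Precolored (G : SimpleGraph V) (s : V → V → ℤ) (L : V → Finset ℤ) (D : Set V)
    (U O K : Finset V) (c₀ : V → ℤ) : Prop where
  connected : ConnectedOn G D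
  notMem : ∀ u ∈ U, u ∉ D
  subset : O ⊆ U
  adj : ∀ u ∈ O, ∃ d ∈ D, G.Adj d u
  subset' : K ⊆ O
  clique : ∀ u ∈ K, ∀ v ∈ K, u ≠ v → G.Adj u v
  card_le : K.card ≤ 2
  three_le : ∀ u ∈ U, u ∉ K → 3 ≤ (L u).card
  five_le : ∀ u ∈ U, u ∉ O → 5 ≤ (L u).card
  ne : ∀ u ∈ K, ∀ v ∈ K, G.Adj u v → c₀ u ≠ s u v * c₀ v

section

variable [DecidableEq V] {G : SimpleGraph V} {s : V → V → ℤ} {L : V → Finset ℤ} {D : Set V}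
  {U O K : Finset V} {c₀ : V → ℤ}

/-- No edge crosses the separation, so `A` can be colored first and its colors on `A ∩ B` taken as
the precoloring of `B`. -/
theorem ExtendsTo.glue {A B : Finset V} (hU : A ∪ B = U)
    (hAB : ∀ x ∈ A, x ∉ B → ∀ y ∈ B, y ∉ A → ¬ G.Adj x y) (hKA : K ⊆ A)
    (hA : ExtendsTo G s L A K c₀)
    (hB : ∀ c : V → ℤ, (∀ u ∈ A, ∀ v ∈ A, G.Adj u v → c u ≠ s u v * c v) →
      ExtendsTo G s L B (A ∩ B) c) : ExtendsTo G s L U K c₀ := by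
  obtain ⟨c₁, h₁, h₁', h₁''⟩ := hA
  obtain ⟨c₂, h₂, h₂', h₂''⟩ := hB c₁ h₁''
  have hB' : ∀ u ∈ B, (if u ∈ A then c₁ u else c₂ u) = c₂ u := by
    intro u hu
    split_ifs with h
    · exact (h₂ u (Finset.mem_inter.mpr ⟨h, hu⟩)).symm
    · rfl
  refine ⟨fun u => if u ∈ A then c₁ u else c₂ u, ?_, ?_, ?_⟩
  · intro u hu
    simp only [if_pos (hKA hu), h₁ u hu]
  · intro u hu huK
    by_cases hA : u ∈ A
    · simp only [if_pos hA, h₁' u hA huK]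
    · have huB : u ∈ B := (Finset.mem_union.mp (hU ▸ hu)).resolve_left hA
      simp only [if_neg hA]
      exact h₂' u huB fun h => hA (Finset.mem_inter.mp h).1
  · intro u hu v hv huv
    have hu' := Finset.mem_union.mp (hU ▸ hu)
    have hv' := Finset.mem_union.mp (hU ▸ hv)
    by_cases hA : u ∈ A ∧ v ∈ A
    · simp only [if_pos hA.1, if_pos hA.2]
      exact h₁'' u hA.1 v hA.2 huv
    · have huB : u ∈ B := by
        by_contra h
        have huA := hu'.resolve_right h
        have hvA : v ∉ A := fun h' => hA ⟨huA, h'⟩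
        exact hAB u huA h v (hv'.resolve_left hvA) hvA huv
      have hvB : v ∈ B := by
        by_contra h
        have hvA := hv'.resolve_right h
        have huA : u ∉ A := fun h' => hA ⟨h', hvA⟩
        exact hAB v hvA h u (hu'.resolve_left huA) huA huv.symm
      simp only [hB' u huB, hB' v hvB]
      exact h₂'' u huB v hvB huv

/-- A coloring of `G[U \ {p}]` extends to `p` by the color `a` if no neighbour of `p` conflicts
with `a`. -/
theorem exists_coloring_insert (hs : ∀ u v, s u v * s v u = 1) {p : V} {a : ℤ} {c : V → ℤ}
    (hc : ∀ u ∈ U.erase p, ∀ v ∈ U.erase p, G.Adj u v → c u ≠ s u v * c v)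
    (ha : ∀ u ∈ U, G.Adj u p → c u ≠ s u p * a) :
    ∀ u ∈ U, ∀ v ∈ U, G.Adj u v →
      Function.update c p a u ≠ s u v * Function.update c p a v := by
  intro u hu v hv huv
  by_cases hup : u = p
  · subst hup
    have hvu : v ≠ u := huv.ne'
    rw [Function.update_self, Function.update_of_ne hvu]
    intro h
    apply ha v hv huv.symm
    rw [h, ← mul_assoc, hs, one_mul]
  · by_cases hvp : v = p
    · subst hvp
      rw [Function.update_self, Function.update_of_ne hup]
      exact ha u hu huv
    · rw [Function.update_of_ne hup, Function.update_of_ne hvp]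
      exact hc u (Finset.mem_erase.mpr ⟨hup, hu⟩) v (Finset.mem_erase.mpr ⟨hvp, hv⟩) huv

open Classical in
/-- Deletion of a colored vertex `p`, whose conflicting colors are removed from the lists of its
neighbours. -/
theorem ExtendsTo.of_erase (hs : ∀ u v, s u v * s v u = 1) {p : V} (hp : p ∈ K)
    (hK : ∀ u ∈ K, ∀ v ∈ K, G.Adj u v → c₀ u ≠ s u v * c₀ v)
    (h : ExtendsTo G s (fun u => if G.Adj u p then (L u).erase (s u p * c₀ p) else L u)
      (U.erase p) (K.erase p) c₀) : ExtendsTo G s L U K c₀ := by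
  obtain ⟨c, h₁, h₂, h₃⟩ := h
  have h₂' : ∀ u ∈ U, u ∉ K → u ≠ p ∧
      c u ∈ if G.Adj u p then (L u).erase (s u p * c₀ p) else L u := fun u hu huK =>
    have hup : u ≠ p := fun e => huK (e ▸ hp)
    ⟨hup, h₂ u (Finset.mem_erase.mpr ⟨hup, hu⟩) fun h => huK (Finset.mem_of_mem_erase h)⟩
  refine ⟨Function.update c p (c₀ p), ?_, ?_, exists_coloring_insert hs h₃ ?_⟩
  · intro u hu
    by_cases hup : u = p
    · rw [hup, Function.update_self]
    · rw [Function.update_of_ne hup]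
      exact h₁ u (Finset.mem_erase.mpr ⟨hup, hu⟩)
  · intro u hu huK
    obtain ⟨hup, h⟩ := h₂' u hu huK
    rw [Function.update_of_ne hup]
    split_ifs at h
    · exact Finset.mem_of_mem_erase h
    · exact h
  · intro u hu hup
    by_cases huK : u ∈ K
    · rw [h₁ u (Finset.mem_erase.mpr ⟨hup.ne, huK⟩)]
      exact hK u huK p hp hup
    · have h := (h₂' u hu huK).2
      rw [if_pos hup] at h
      exact Finset.ne_of_mem_erase h

theorem ExtendsTo.of_insert {v : V} (hv : v ∈ U) (hvK : v ∉ K) {a : ℤ} (ha : a ∈ L v)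
    (h : ExtendsTo G s L U (insert v K) (Function.update c₀ v a)) : ExtendsTo G s L U K c₀ := by
  obtain ⟨c, h₁, h₂, h₃⟩ := h
  refine ⟨c, fun u hu => ?_, fun u hu huK => ?_, h₃⟩
  · rw [h₁ u (Finset.mem_insert_of_mem hu), Function.update_of_ne]
    rintro rfl
    exact hvK hu
  · by_cases huv : u = v
    · rw [huv, h₁ v (Finset.mem_insert_self v K), Function.update_self]
      exact ha
    · exact h₂ u hu fun h => (Finset.mem_insert.mp h).elim huv huK

namespace Precolored

/-- Deletion of a precolored vertex without further neighbours in `O`. -/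
theorem erase (h : Precolored G s L D U O K c₀) {p : V} (hp : p ∈ K)
    (hpO : ∀ u ∈ O, u ∉ K → ¬ G.Adj p u) [DecidableRel G.Adj] :
    Precolored G s (fun u => if G.Adj u p then (L u).erase (s u p * c₀ p) else L u) (D ∪ {p})
      (U.erase p) ((U.erase p).filter fun u => u ∈ O ∨ G.Adj p u) (K.erase p) c₀ where
  connected := by
    obtain ⟨d, hd, hdp⟩ := h.adj p (h.subset' hp)
    exact h.connected.union (connectedOn_singleton G p) hd rfl hdp
  notMem u hu := by
    rw [Finset.mem_erase] at hu
    rintro (h' | h')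
    · exact h.notMem u hu.2 h'
    · exact hu.1 h'
  subset := Finset.filter_subset _ _
  adj u hu := by
    rcases (Finset.mem_filter.mp hu).2 with h' | h'
    · obtain ⟨d, hd, hdu⟩ := h.adj u h'
      exact ⟨d, Or.inl hd, hdu⟩
    · exact ⟨p, Or.inr rfl, h'⟩
  subset' u hu := by
    rw [Finset.mem_erase] at hu
    exact Finset.mem_filter.mpr ⟨Finset.mem_erase.mpr ⟨hu.1, h.subset (h.subset' hu.2)⟩,
      Or.inl (h.subset' hu.2)⟩
  clique u hu v hv := h.clique u (Finset.mem_of_mem_erase hu) v (Finset.mem_of_mem_erase hv)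
  card_le := (Finset.card_erase_le).trans h.card_le
  three_le u hu huK := by
    rw [Finset.mem_erase] at hu
    have huK' : u ∉ K := fun h' => huK (Finset.mem_erase.mpr ⟨hu.1, h'⟩)
    split_ifs with hadj
    · have := h.five_le u hu.2 fun hO => hpO u hO huK' hadj.symm
      have := Finset.pred_card_le_card_erase (s := L u) (a := s u p * c₀ p)
      omega
    · exact h.three_le u hu.2 huK'
  five_le u hu huO := by
    have hu' := Finset.mem_erase.mp hu
    simp only [Finset.mem_filter, hu, true_and, not_or] at huO
    rw [if_neg fun h => huO.2 h.symm]
    exact h.five_le u hu'.2 huO.1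
  ne u hu v hv := h.ne u (Finset.mem_of_mem_erase hu) v (Finset.mem_of_mem_erase hv)

/-- If no vertex of `U` is known to have a neighbour in `D`, restart with `D = {v}`. -/
theorem restart (h : Precolored G s L D U ∅ K c₀) {v : V} (a : ℤ) [DecidableRel G.Adj] :
    Precolored G s (fun u => if G.Adj u v then (L u).erase (s u v * a) else L u) {v}
      (U.erase v) ((U.erase v).filter fun u => G.Adj v u) ∅ c₀ where
  connected := connectedOn_singleton G v
  notMem u hu := Finset.ne_of_mem_erase hu
  subset := Finset.filter_subset _ _
  adj u hu := ⟨v, rfl, (Finset.mem_filter.mp hu).2⟩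
  subset' := Finset.empty_subset _
  clique u hu := absurd hu (Finset.notMem_empty u)
  card_le := Nat.zero_le _
  three_le u hu _ := by
    have := h.five_le u (Finset.mem_of_mem_erase hu) (Finset.notMem_empty u)
    split_ifs with hadj
    · have := Finset.pred_card_le_card_erase (s := L u) (a := s u v * a)
      omega
    · omega
  five_le u hu huO := by
    simp only [Finset.mem_filter, hu, true_and] at huO
    rw [if_neg fun h => huO h.symm]
    exact h.five_le u (Finset.mem_of_mem_erase hu) (Finset.notMem_empty u)
  ne u hu := absurd hu (Finset.notMem_empty u)

/-- Deletion of a vertex `v` of `O` for which two colors `a`, `b` are reserved. -/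
theorem erase_two (h : Precolored G s L D U O K c₀) {v : V} (hv : v ∈ O) (hvK : v ∉ K) (a b : ℤ)
    [DecidableRel G.Adj] :
    Precolored G s
      (fun u => if G.Adj u v ∧ u ∉ O then ((L u).erase (s u v * a)).erase (s u v * b) else L u)
      (D ∪ {v}) (U.erase v) ((U.erase v).filter fun u => u ∈ O ∨ G.Adj v u) K c₀ where
  connected := by
    obtain ⟨d, hd, hdv⟩ := h.adj v hv
    exact h.connected.union (connectedOn_singleton G v) hd rfl hdv
  notMem u hu := by
    rw [Finset.mem_erase] at hu
    rintro (h' | h')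
    · exact h.notMem u hu.2 h'
    · exact hu.1 h'
  subset := Finset.filter_subset _ _
  adj u hu := by
    rcases (Finset.mem_filter.mp hu).2 with h' | h'
    · obtain ⟨d, hd, hdu⟩ := h.adj u h'
      exact ⟨d, Or.inl hd, hdu⟩
    · exact ⟨v, Or.inr rfl, h'⟩
  subset' u hu := Finset.mem_filter.mpr ⟨Finset.mem_erase.mpr ⟨fun e => hvK (e ▸ hu),
    h.subset (h.subset' hu)⟩, Or.inl (h.subset' hu)⟩
  clique := h.clique
  card_le := h.card_le
  three_le u hu huK := by
    have hu' := Finset.mem_erase.mp hu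
    split_ifs with hadj
    · have := h.five_le u hu'.2 hadj.2
      have := Finset.pred_card_le_card_erase (s := L u) (a := s u v * a)
      have := Finset.pred_card_le_card_erase (s := (L u).erase (s u v * a)) (a := s u v * b)
      omega
    · exact h.three_le u hu'.2 huK
  five_le u hu huO := by
    have hu' := Finset.mem_erase.mp hu
    simp only [Finset.mem_filter, hu, true_and, not_or] at huO
    rw [if_neg fun h => huO.2 h.1.symm]
    exact h.five_le u hu'.2 huO.1
  ne := h.ne

/-- A vertex of `O` adjacent to all of `K` can be precolored. -/
theorem insert (h : Precolored G s L D U O K c₀) (hs : ∀ u v, s u v * s v u = 1) {v : V}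
    (hv : v ∈ O) (hvK : v ∉ K) (hK : K.card ≤ 1) (hadj : ∀ u ∈ K, G.Adj u v) {a : ℤ}
    (ha : ∀ u ∈ K, c₀ u ≠ s u v * a) :
    Precolored G s L D U O (insert v K) (Function.update c₀ v a) where
  connected := h.connected
  notMem := h.notMem
  subset := h.subset
  adj := h.adj
  subset' := Finset.insert_subset hv h.subset'
  clique x hx y hy hxy := by
    rcases Finset.mem_insert.mp hx with rfl | hx' <;> rcases Finset.mem_insert.mp hy with rfl | hy'
    · exact absurd rfl hxy
    · exact (hadj y hy').symm
    · exact hadj x hx'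
    · exact h.clique x hx' y hy' hxy
  card_le := (Finset.card_insert_le v K).trans (by omega)
  three_le u hu huK := h.three_le u hu fun h => huK (Finset.mem_insert_of_mem h)
  five_le := h.five_le
  ne := exists_coloring_insert hs
    (by rw [Finset.erase_insert hvK]; exact h.ne)
    (by
      intro u hu huv
      exact ha u ((Finset.mem_insert.mp hu).resolve_left huv.ne))

/-- The part of a separation which contains the precolored vertices. -/
theorem mono (h : Precolored G s L D U O K c₀) {A : Finset V} (hA : A ⊆ U) (hK : K ⊆ A) :
    Precolored G s L D A (O ∩ A) K c₀ where
  connected := h.connected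
  notMem u hu := h.notMem u (hA hu)
  subset := Finset.inter_subset_right
  adj u hu := h.adj u (Finset.mem_inter.mp hu).1
  subset' := Finset.subset_inter h.subset' hK
  clique := h.clique
  card_le := h.card_le
  three_le u hu := h.three_le u (hA hu)
  five_le u hu huO := h.five_le u (hA hu) fun h => huO (Finset.mem_inter.mpr ⟨h, hu⟩)
  ne := h.ne

/-- The part of a separation which does not contain the precolored vertices. -/
theorem other_side (h : Precolored G s L D U O K c₀) {A B : Finset V} (hB : B ⊆ U) (hK : K ⊆ A)
    (hO : A ∩ B ⊆ O) (hcl : ∀ x ∈ A ∩ B, ∀ y ∈ A ∩ B, x ≠ y → G.Adj x y)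
    (hcard : (A ∩ B).card ≤ 2) {c : V → ℤ}
    (hc : ∀ u ∈ A, ∀ v ∈ A, G.Adj u v → c u ≠ s u v * c v) :
    Precolored G s L D B (O ∩ B) (A ∩ B) c where
  connected := h.connected
  notMem u hu := h.notMem u (hB hu)
  subset := Finset.inter_subset_right
  adj u hu := h.adj u (Finset.mem_inter.mp hu).1
  subset' := Finset.subset_inter hO Finset.inter_subset_right
  clique := hcl
  card_le := hcard
  three_le u hu huAB := h.three_le u (hB hu) fun h => huAB (Finset.mem_inter.mpr ⟨hK h, hu⟩)
  five_le u hu huO := h.five_le u (hB hu) fun h => huO (Finset.mem_inter.mpr ⟨h, hu⟩)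
  ne u hu v hv := hc u (Finset.mem_inter.mp hu).1 v (Finset.mem_inter.mp hv).1

/-- Extension of a coloring of `G[U \ {v}]` to `v`, for which two colors are reserved. -/
theorem extendsTo_of_erase_two (h : Precolored G s L D U O K c₀) (hs : ∀ u v, s u v * s v u = 1)
    [DecidableRel G.Adj] {p v : V} (hp : p ∈ K) (hvK : v ∉ K)
    (hw : ∀ x ∈ O, ∀ y ∈ O, x ≠ p → y ≠ p → G.Adj v x → G.Adj v y → x = y)
    {a b : ℤ} (ha : a ∈ L v) (hb : b ∈ L v) (hab : a ≠ b) (hpa : c₀ p ≠ s p v * a)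
    (hpb : c₀ p ≠ s p v * b)
    (hE : ExtendsTo G s
      (fun u => if G.Adj u v ∧ u ∉ O then ((L u).erase (s u v * a)).erase (s u v * b) else L u)
      (U.erase v) K c₀) : ExtendsTo G s L U K c₀ := by
  obtain ⟨c, h₁, h₂, h₃⟩ := hE
  -- Apart from `p`, at most one neighbor of `v` lies in `O`, and it rules out at most one of `a`
  -- and `b`; `e` is a color that is left.
  obtain ⟨e, he, heL, hep, hew⟩ : ∃ e, (e = a ∨ e = b) ∧ e ∈ L v ∧ c₀ p ≠ s p v * e ∧
      ∀ x ∈ O, x ≠ p → G.Adj v x → c x ≠ s x v * e := by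
    by_cases hx : ∃ x ∈ O, x ≠ p ∧ G.Adj v x ∧ c x = s x v * a
    · obtain ⟨x, hxO, hxp, hvx, hcx⟩ := hx
      refine ⟨b, Or.inr rfl, hb, hpb, fun y hyO hyp hvy hcy => hab ?_⟩
      obtain rfl := hw x hxO y hyO hxp hyp hvx hvy
      have := congrArg (s v x * ·) (hcx.symm.trans hcy)
      simpa [← mul_assoc, hs] using this
    · push Not at hx
      exact ⟨a, Or.inl rfl, ha, hpa, hx⟩
  refine ⟨Function.update c v e, ?_, ?_, exists_coloring_insert hs h₃ ?_⟩
  · intro u hu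
    rw [Function.update_of_ne (ne_of_mem_of_not_mem hu hvK), h₁ u hu]
  · intro u hu huK
    by_cases huv : u = v
    · rw [huv, Function.update_self]
      exact heL
    · rw [Function.update_of_ne huv]
      have := h₂ u (Finset.mem_erase.mpr ⟨huv, hu⟩) huK
      dsimp only at this
      split_ifs at this
      · exact Finset.mem_of_mem_erase (Finset.mem_of_mem_erase this)
      · exact this
  · intro u hu huv
    by_cases hup : u = p
    · rw [hup, h₁ p hp]
      exact hep
    · by_cases huO : u ∈ O
      · exact hew u huO hup huv.symm
      · have := h₂ u (Finset.mem_erase.mpr ⟨huv.ne, hu⟩) fun h' => huO (h.subset' h')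
        simp only [if_pos (And.intro huv huO)] at this
        rcases he with rfl | rfl
        · exact Finset.ne_of_mem_erase (Finset.mem_of_mem_erase this)
        · exact Finset.ne_of_mem_erase this

end Precolored

/-- **Thomassen's induction** for signed graphs. -/
theorem Precolored.extendsTo (hs : ∀ u v, s u v * s v u = 1) (h5 : NoCompleteFiveMinor G)
    (h6 : NoBipartiteThreeMinor G) (h : Precolored G s L D U O K c₀) :
    ExtendsTo G s L U K c₀ := by
  classical
  -- Precoloring another vertex lowers the second term. Shrinking `U` may shrink `K` too, but raises
  -- that term by at most 2, which the factor 3 outweighs.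
  obtain ⟨m, hm⟩ : ∃ m, m = 3 * U.card + (2 - K.card) := ⟨_, rfl⟩
  induction m using Nat.strong_induction_on generalizing L D U O K c₀ with
  | _ m ih =>
  subst hm
  have hK2 := h.card_le
  have hKU : K ⊆ U := h.subset'.trans h.subset
  by_cases hsep : Unseparated G U O
  swap
  · have key : ∀ A B : Finset V, A ∪ B = U →
        (∀ x ∈ A, x ∉ B → ∀ y ∈ B, y ∉ A → ¬ G.Adj x y) → A ∩ B ⊆ O →
        (∀ x ∈ A ∩ B, ∀ y ∈ A ∩ B, x ≠ y → G.Adj x y) → (A ∩ B).card ≤ 2 → A ≠ U → B ≠ U →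
        K ⊆ A → ExtendsTo G s L U K c₀ := by
      intro A B hU hAB hO hcl hcard hA hB hKA
      have hAU : A ⊆ U := hU ▸ Finset.subset_union_left
      have hBU : B ⊆ U := hU ▸ Finset.subset_union_right
      have hA' : A.card < U.card := Finset.card_lt_card (hAU.ssubset_of_ne hA)
      have hB' : B.card < U.card := Finset.card_lt_card (hBU.ssubset_of_ne hB)
      refine ExtendsTo.glue hU hAB hKA
        (ih _ (by omega) (h.mono hAU hKA) rfl) fun c hc =>
        ih _ (by omega) (h.other_side hBU hKA hO hcl hcard hc) rfl
    unfold Unseparated at hsep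
    push Not at hsep
    obtain ⟨A, B, hU, hAB, hO, hcl, hcard, hA, hB⟩ := hsep
    by_cases hKA : K ⊆ A
    · exact key A B hU hAB hO hcl hcard hA hB hKA
    -- A clique cannot have vertices strictly on both sides, so `K` lies in `B`.
    · obtain ⟨x, hxK, hxA⟩ := Finset.not_subset.mp hKA
      have hxB : x ∈ B := (Finset.mem_union.mp (hU ▸ hKU hxK)).resolve_left hxA
      refine key B A (Finset.union_comm A B ▸ hU)
        (fun x hx hx' y hy hy' hxy => hAB y hy hy' x hx hx' hxy.symm)
        (Finset.inter_comm A B ▸ hO) (Finset.inter_comm A B ▸ hcl)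
        (Finset.inter_comm A B ▸ hcard) hB hA fun y hyK => ?_
      by_contra hyB
      have hyA : y ∈ A := (Finset.mem_union.mp (hU ▸ hKU hyK)).resolve_right hyB
      exact hAB y hyA hyB x hxB hxA (h.clique y hyK x hxK fun e => hyB (e ▸ hxB))
  by_cases hdel : ∃ p ∈ K, ∀ u ∈ O, u ∉ K → ¬ G.Adj p u
  · -- a precolored vertex without further neighbours in `O`
    obtain ⟨p, hp, hpO⟩ := hdel
    have hcard := Finset.card_erase_lt_of_mem (hKU hp)
    have h' := h.erase hp hpO
    refine ExtendsTo.of_erase hs hp h.ne ?_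
    convert! ih _ (by omega) h' rfl
  push Not at hdel
  rcases K.eq_empty_or_nonempty with rfl | ⟨p, hp⟩
  · rcases O.eq_empty_or_nonempty with rfl | ⟨v, hv⟩
    · rcases U.eq_empty_or_nonempty with rfl | ⟨v, hv⟩
      · exact ⟨c₀, by simp, by simp, by simp⟩
      -- With `O` empty all lists have five colors; any vertex is colored and becomes the new `D`,
      -- costing its neighbors one color each.
      · have h5v := h.five_le v hv (Finset.notMem_empty v)
        obtain ⟨a, ha⟩ : (L v).Nonempty := Finset.card_pos.mp (by omega)
        have hcard := Finset.card_erase_lt_of_mem hv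
        refine ExtendsTo.of_insert hv (Finset.notMem_empty v) ha
          (ExtendsTo.of_erase hs (Finset.mem_insert_self v ∅) ?_ ?_)
        · simp
        · obtain ⟨c, -, h₂, h₃⟩ := ih _ (by simp; omega) (h.restart (v := v) a) rfl
          refine ⟨c, by simp, fun u hu _ => ?_, h₃⟩
          simpa using h₂ u hu (Finset.notMem_empty u)
    · obtain ⟨a, ha⟩ : (L v).Nonempty := Finset.card_pos.mp (by
        have := h.three_le v (h.subset hv) (Finset.notMem_empty v)
        omega)
      refine ExtendsTo.of_insert (h.subset hv) (Finset.notMem_empty v) ha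
        (ih _ (by simp) (h.insert hs hv (Finset.notMem_empty v) (by simp) (by simp) (by simp)) rfl)
  obtain ⟨v, hv, hvK, hpv⟩ := hdel p hp
  have h3v := h.three_le v (h.subset hv) hvK
  have hconf : ∀ a ∈ (L v).erase (s v p * c₀ p), c₀ p ≠ s p v * a := by
    intro a ha e
    apply Finset.ne_of_mem_erase ha
    rw [e, ← mul_assoc, hs, one_mul]
  have hcard := Finset.pred_card_le_card_erase (s := L v) (a := s v p * c₀ p)
  -- Of the at least three colors of `v`, the precolored `p` forbids one, so two can be reserved.
  obtain ⟨a, ha, b, hb, hab⟩ := Finset.one_lt_card.mp (show 1 < ((L v).erase (s v p * c₀ p)).card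
    by omega)
  by_cases hK1 : K.card ≤ 1
  · have hKp : ∀ u ∈ K, u = p := fun u hu => Finset.card_le_one.mp hK1 u hu p hp
    refine ExtendsTo.of_insert (h.subset hv) hvK (Finset.mem_of_mem_erase ha)
      (ih _ ?_ (h.insert hs hv hvK hK1 (fun u hu => hKp u hu ▸ hpv)
        fun u hu => hKp u hu ▸ hconf a ha) rfl)
    rw [Finset.card_insert_of_notMem hvK]
    omega
  · have hUv := Finset.card_erase_lt_of_mem (h.subset hv)
    refine h.extendsTo_of_erase_two hs hp hvK ?_ (Finset.mem_of_mem_erase ha)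
      (Finset.mem_of_mem_erase hb) hab (hconf a ha) (hconf b hb)
      (ih _ (by omega) (h.erase_two hv hvK a b) rfl)
    -- Otherwise `p`, `x` and `y` are three neighbors of `v` in `O`.
    intro x hx y hy hxp hyp hvx hvy
    by_contra hxy
    exact hsep.not_three_adj h5 h6 h.connected h.notMem h.subset h.adj hv (h.subset' hp) hx hy
      hxp.symm hyp.symm hxy hpv.symm hvx hvy

end

/-! ### Application to planar signed graphs. -/

namespace SignedGraph

theorem isChoosable_five_of_isPlanar [Finite V] (S : SignedGraph V) (hS : IsPlanar S.graph) :
    S.IsChoosable 5 := by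
  classical
  intro L hL
  have := Fintype.ofFinite V
  -- The value 1 off the edges makes `s u v * s v u = 1` hold for all pairs.
  let s : V → V → ℤ := fun u v =>
    if h : S.graph.Adj u v then (S.sign ⟨s(u, v), S.graph.mem_edgeSet.mpr h⟩ : ℤˣ) else 1
  have hs : ∀ u v, s u v * s v u = 1 := by
    intro u v
    by_cases h : S.graph.Adj u v
    · have e : (⟨s(v, u), S.graph.mem_edgeSet.mpr h.symm⟩ : S.graph.edgeSet) =
          ⟨s(u, v), S.graph.mem_edgeSet.mpr h⟩ := Subtype.ext Sym2.eq_swap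
      simp only [s, dif_pos h, dif_pos h.symm, e]
      rw [← Units.val_mul, Int.units_mul_self, Units.val_one]
    · have h' : ¬ S.graph.Adj v u := fun e => h e.symm
      simp [s, h, h']
  -- The induction starts with no exterior and nothing precolored; the empty `D` counts as
  -- connected.
  have hP : Precolored S.graph s L ∅ Finset.univ ∅ ∅ 0 :=
    { connected := fun T hT _ _ => Set.empty_subset T
      notMem := by simp
      subset := by simp
      adj := by simp
      subset' := by simp
      clique := by simp
      card_le := by simp
      three_le := fun u _ _ => (by omega : 3 ≤ 5).trans (hL u)
      five_le := fun u _ _ => hL u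
      ne := by simp }
  obtain ⟨c, -, h₂, h₃⟩ := hP.extendsTo hs hS.noCompleteFiveMinor hS.noBipartiteThreeMinor
  refine ⟨c, fun u v h => ?_, fun v => h₂ v (Finset.mem_univ v) (Finset.notMem_empty v)⟩
  simpa only [s, dif_pos h] using h₃ u (Finset.mem_univ u) v (Finset.mem_univ v) h

end SignedGraph

end

theorem mainTheorem2 {V : Type*} [Finite V] (S : SignedGraph V) (hS : IsPlanar S.graph) :
    S.IsChoosable 5 ∧ S.listChromaticNumber ≤ 5 :=
  have h := S.isChoosable_five_of_isPlanar hS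
  ⟨h, Nat.sInf_le h⟩
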